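/- Let $F=\langle x_0,x_1,x_2,\ldots \mid x_jx_i=x_ix_{j+1}\ (0\le i<j)\rangle$ be R. Thompson's group, which is generated by $A=\{x_0,x_1\}$, and let $\Gamma$ be its Cayley graph (right or left) with respect to $A$: its vertex set is $F$ and for every $g\in F$ and every $a\in A^{\pm1}$ there is a directed edge labelled by $a$ from $g$ to $ga$ (right Cayley graph), respectively from $ag$ to $g$ (left Cayley graph), so that exactly $4$ directed edges start at each vertex. For a finite nonempty set $Y\subset F$ let $\delta(Y)$ be the average vertex degree of the subgraph of $\Gamma$ spanned by $Y$, that is, the number of directed edges with both endpoints in $Y$ divided by $|Y|$, and let $\iota_*(Y)=|\partial_*Y|/|Y|$, where $\partial_*Y$ is the set of directed edges that start in $Y$ and end outside $Y$. The density of $\Gamma$ is $\sup_Y\delta(Y)$ and its Cheeger isoperimetric constant is $\inf_Y\iota_*(Y)$, both taken over all finite nonempty $Y\subset F$. Theorem. The density of $\Gamma$ is strictly greater than $3.5$. Equivalently, the Cheeger isoperimetric constant of $\Gamma$ is strictly less than $\frac12$. Moreover, there is a finite nonempty $Y\subset F$ with $\delta(Y)>3.5+\frac1{2400}$. All this holds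 for the right and for the left Cayley graph. -/

import Mathlib

/-- A graph in the sense of Serre, with vertex set `V` and set of directed edges `E`. -/
structure SerreGraph (V E : Type*) where
  /-- the inverse of a directed edge -/
  inv : E → E
  /-- the initial vertex of a directed edge -/
  init : E → V
  /-- the terminal vertex of a directed edge -/
  term : E → V
  inv_ne : ∀ e, inv e ≠ e
  inv_inv : ∀ e, inv (inv e) = e
  init_inv : ∀ e, init (inv e) = term e
  term_inv : ∀ e, term (inv e) = init e

namespace SerreGraph

variable {V E : Type*} (Γ : SerreGraph V E)

/-- The degree of the vertex `v` in the subgraph of `Γ` spanned by `Y`: the number of directed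
edges that start at `v` and end in `Y`. -/
noncomputable def degreeIn (Y : Finset V) (v : V) : ℕ :=
  {e : E | Γ.init e = v ∧ Γ.term e ∈ Y}.ncard

/-- The density of the finite subgraph spanned by `Y`: its average vertex degree. -/
noncomputable def subgraphDensity (Y : Finset V) : ℝ :=
  (∑ v ∈ Y, (Γ.degreeIn Y v : ℝ)) / (Y.card : ℝ)

/-- The Cheeger boundary of `Y`: the directed edges from a vertex of `Y` to a vertex
outside `Y`. -/
def cheegerBoundary (Y : Finset V) : Set E :=
  {e : E | Γ.init e ∈ Y ∧ Γ.term e ∉ Y}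

/-- The Cheeger isoperimetric constant of the finite subgraph spanned by `Y`. -/
noncomputable def subgraphCheeger (Y : Finset V) : ℝ :=
  ((Γ.cheegerBoundary Y).ncard : ℝ) / (Y.card : ℝ)

/-- The density of `Γ` (a graph of bounded degree): the supremum of the densities of its finite
nonempty subgraphs. -/
noncomputable def density : ℝ :=
  sSup {d : ℝ | ∃ Y : Finset V, Y.Nonempty ∧ d = Γ.subgraphDensity Y}

/-- The Cheeger isoperimetric constant of `Γ` (a graph of bounded degree): the infimum of the
Cheeger isoperimetric constants of its finite nonempty subgraphs. -/
noncomputable def cheegerConstant : ℝ :=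
  sInf {c : ℝ | ∃ Y : Finset V, Y.Nonempty ∧ c = Γ.subgraphCheeger Y}

end SerreGraph

/-- The element of `G` represented by a letter of `A ∪ A⁻¹`: `(a, true)` stands for the letter `a`
and `(a, false)` for the letter `a⁻¹`. -/
def letterValue {G : Type*} [Group G] {A : Set G} (l : A × Bool) : G :=
  if l.2 then (l.1 : G) else (l.1 : G)⁻¹

/-- The formal inverse of a letter. -/
def letterInv {G : Type*} {A : Set G} (l : A × Bool) : A × Bool :=
  (l.1, !l.2)

theorem letterValue_letterInv {G : Type*} [Group G] {A : Set G} (l : A × Bool) :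
    letterValue (letterInv l) = (letterValue l)⁻¹ := by
  rcases l with ⟨a, _ | _⟩ <;> simp [letterValue, letterInv]

theorem letterInv_letterInv {G : Type*} {A : Set G} (l : A × Bool) :
    letterInv (letterInv l) = l := by
  simp [letterInv]

theorem letterInv_ne {G : Type*} {A : Set G} (l : A × Bool) : letterInv l ≠ l := by
  rcases l with ⟨a, _ | _⟩ <;> simp [letterInv]

/-- The right Cayley graph of `G` with respect to the set `A` of generators: the directed edge
`(g, a)` with label `a` goes from `g` to `g * a`. -/
def rightCayleyGraph (G : Type*) [Group G] (A : Set G) : SerreGraph G (G × (A × Bool)) where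
  inv e := (e.1 * letterValue e.2, letterInv e.2)
  init e := e.1
  term e := e.1 * letterValue e.2
  inv_ne e h := letterInv_ne e.2 (congrArg Prod.snd h)
  inv_inv e := by simp [letterValue_letterInv, letterInv_letterInv]
  init_inv _ := rfl
  term_inv e := by simp [letterValue_letterInv]

/-- The left Cayley graph of `G` with respect to the set `A` of generators: the directed edge
`(a, g)` with label `a` goes from `a * g` to `g`. -/
def leftCayleyGraph (G : Type*) [Group G] (A : Set G) : SerreGraph G ((A × Bool) × G) where
  inv e := (letterInv e.1, letterValue e.1 * e.2)
  init e := letterValue e.1 * e.2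
  term e := e.2
  inv_ne e h := letterInv_ne e.1 (congrArg Prod.fst h)
  inv_inv e := by simp [letterValue_letterInv, letterInv_letterInv]
  init_inv e := by simp [letterValue_letterInv]
  term_inv _ := rfl

/-- The defining relators `x_j x_i (x_i x_{j+1})⁻¹`, `0 ≤ i < j`, of Thompson's group `F`. -/
def thompsonRelators : Set (FreeGroup ℕ) :=
  {r | ∃ i j : ℕ, i < j ∧
    r = FreeGroup.of j * FreeGroup.of i * (FreeGroup.of i * FreeGroup.of (j + 1))⁻¹}

/-- Thompson's group `F = ⟨x_0, x_1, x_2, … ∣ x_j x_i = x_i x_{j+1} (0 ≤ i < j)⟩`. -/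
abbrev ThompsonF : Type := PresentedGroup thompsonRelators

/-- The generator `x_n` of Thompson's group `F`. -/
def thompsonX (n : ℕ) : ThompsonF := PresentedGroup.of n

/-- The standard generating set `{x_0, x_1}` of Thompson's group `F`. -/
def thompsonStd : Set ThompsonF := {thompsonX 0, thompsonX 1}

/-! A pointed forest represents an element of F by `toF`, injectively once the number n of leaves is
fixed (`toF_injOn_size`). Left multiplication by x_0 moves the pointer one tree to the right, and by
x_1 joins the marked tree to the next one (`toF_shift`, `toF_merge`). Hence finite sets of such
forests give finite subsets of F. The Cheeger boundary of a set (or of its inverses, on the right)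
is twice the number of its points that x_0 or x_1 moves out, and density plus Cheeger constant of a
subgraph is 4.

Take all trees of height at most k + 1 and weight a forest by x^(leaves), with x chosen so that
these trees have total weight 1; then x is near 1/4 for suitable k. The generator x_0 leaves the
family only at the ends of a forest, which is negligible for long forests. The generator x_1 stays
if both trees have height at most k, an event of weight s² = 1 - x, about 3/4. This yields the
Cheeger constant 2 · 1/4 = 1/2 in the limit, but nothing below it.

The gain comes from removing forests whose pointer is at the first, second or third tree of a
pattern leaf, high, leaf, high, where high means height k + 1. At all three positions x_1 leaves the
family anyway. Let F, S, T count these positions, F without those that are also third. New exits by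
x_0 only enter F, new exits by x_1 only enter S, while F + S + T exits by x_1 disappear. Thus T
exits are saved, worth 2T, and the lost cardinality costs about (F + S + T)/2, or 3T/2. The net gain
T/2 has relative weight b/2 with b = (x(1 - s))², about 0.00112, and b/2 > 1/2400. Some n then does
at least as well as the weighted average (`exists_slice_sum_neg`). -/

/-- Finite rooted binary trees. -/
inductive BinTree
  | leaf : BinTree
  | node : BinTree → BinTree → BinTree
  deriving DecidableEq

namespace BinTree

/-- The number of leaves of a binary tree. -/
def leaves : BinTree → ℕ
  | leaf => 1
  | node a b => a.leaves + b.leaves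

/-- The number of vertices of a binary tree. -/
def vertices : BinTree → ℕ
  | leaf => 1
  | node a b => a.vertices + b.vertices + 1

theorem leaves_pos (t : BinTree) : 0 < t.leaves := by
  induction t with
  | leaf => simp [leaves]
  | node a b iha _ => simp only [leaves]; omega

/-! ### Forests as elements of Thompson's group -/

/-- The element of Thompson's group that builds the tree `t` from the leaves number
`i, i + 1, …`; the product is read from right to left. -/
def elt : ℕ → BinTree → ThompsonF
  | _, leaf => 1
  | i, node a b => thompsonX i * (elt (i + 1) b * elt i a)

end BinTree

open BinTree

/-- The number of leaves of a binary forest. -/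
def forestLeaves (ts : List BinTree) : ℕ := (ts.map leaves).sum

/-- The element of Thompson's group that builds the forest `ts` from the leaves number
`i, i + 1, …`. -/
def forestElt : ℕ → List BinTree → ThompsonF
  | _, [] => 1
  | i, t :: ts => forestElt (i + 1) ts * elt i t

theorem thompsonX_comm {i j : ℕ} (h : i < j) :
    thompsonX j * thompsonX i = thompsonX i * thompsonX (j + 1) := by
  have h1 : PresentedGroup.mk thompsonRelators
      (FreeGroup.of j * FreeGroup.of i * (FreeGroup.of i * FreeGroup.of (j + 1))⁻¹) = 1 :=
    PresentedGroup.one_of_mem ⟨i, j, h, rfl⟩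
  simp only [map_mul, map_inv] at h1
  exact mul_inv_eq_one.mp h1

/-- Every generator in `elt j t` has index at least j > i, so x_i passes each one and shifts its
index. -/
theorem thompsonX_mul_elt {i j : ℕ} (h : i < j) (t : BinTree) :
    thompsonX i * elt (j + 1) t = elt j t * thompsonX i := by
  induction t generalizing j with
  | leaf => simp [elt]
  | node a b iha ihb =>
    simp only [elt]
    rw [← mul_assoc, ← thompsonX_comm h, mul_assoc, ← mul_assoc (thompsonX i),
      ihb (Nat.lt_succ_of_lt h), mul_assoc, iha h]
    simp only [mul_assoc]

theorem thompsonX_mul_forestElt {i j : ℕ} (h : i < j) (ts : List BinTree) :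
    thompsonX i * forestElt (j + 1) ts = forestElt j ts * thompsonX i := by
  induction ts generalizing j with
  | nil => simp [forestElt]
  | cons t ts ih =>
    simp only [forestElt]
    rw [← mul_assoc, ih (Nat.lt_succ_of_lt h), mul_assoc, thompsonX_mul_elt h, mul_assoc]

/-- The first root caret can be attached last, since the remaining trees are built further to the
right. -/
theorem forestElt_node_cons (i : ℕ) (a b : BinTree) (ts : List BinTree) :
    forestElt i (node a b :: ts) = thompsonX i * forestElt i (a :: b :: ts) := by
  simp only [forestElt, elt]
  rw [← mul_assoc, ← thompsonX_mul_forestElt (Nat.lt_succ_self i)]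
  simp only [mul_assoc]

theorem forestElt_append (i : ℕ) (ts us : List BinTree) :
    forestElt i (ts ++ us) = forestElt (i + ts.length) us * forestElt i ts := by
  induction ts generalizing i with
  | nil => simp [forestElt]
  | cons t ts ih =>
    simp only [List.cons_append, forestElt, ih, List.length_cons, mul_assoc]
    rw [show i + 1 + ts.length = i + (ts.length + 1) by ring]

theorem thompsonX_one_mul_pow (q : ℕ) :
    thompsonX 1 * thompsonX 0 ^ q = thompsonX 0 ^ q * thompsonX (q + 1) := by
  induction q with
  | zero => simp
  | succ q ih =>
    rw [pow_succ, ← mul_assoc, ih, mul_assoc, thompsonX_comm (Nat.succ_pos q), mul_assoc]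

/-! ### A faithful enough action of Thompson's group -/

/-- The piecewise linear bijection of `ℚ` that halves `[i, i + 2]` onto `[i, i + 1]`. -/
def halving (i : ℕ) : Equiv.Perm ℚ where
  toFun t := min t (max ((t + i) / 2) (t - 1))
  invFun s := max s (min (2 * s - i) (s + 1))
  left_inv t := by
    simp only [min_def, max_def]
    split_ifs <;> linarith
  right_inv s := by
    simp only [min_def, max_def]
    split_ifs <;> linarith

theorem halving_apply (i : ℕ) (t : ℚ) : halving i t = min t (max ((t + i) / 2) (t - 1)) := rfl

theorem halving_le (i : ℕ) (t : ℚ) : halving i t ≤ t := min_le_left _ _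

theorem halving_eq_self {i : ℕ} {t : ℚ} (h : t ≤ i) : halving i t = t := by
  rw [halving_apply]
  exact min_eq_left (le_max_of_le_left (by linarith))

theorem halving_lt {i : ℕ} {t : ℚ} (h : t ≤ i + 1) : halving i t < i + 1 := by
  rw [halving_apply]
  exact min_lt_of_right_lt (max_lt (by linarith) (by linarith))

theorem halving_eq_midpoint {i : ℕ} {t : ℚ} (h1 : i ≤ t) (h2 : t ≤ i + 2) :
    halving i t = (t + i) / 2 := by
  rw [halving_apply, max_eq_left (by linarith), min_eq_right (by linarith)]

theorem halving_eq_sub_one {i : ℕ} {t : ℚ} (h : i + 2 ≤ t) : halving i t = t - 1 := by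
  rw [halving_apply, max_eq_right (by linarith), min_eq_right (by linarith)]

theorem halving_comm {i j : ℕ} (h : i < j) :
    halving j * halving i = halving i * halving (j + 1) := by
  have h' : (i : ℚ) + 1 ≤ j := by exact_mod_cast h
  ext t
  simp only [Equiv.Perm.mul_apply]
  rcases le_total t (j + 1) with h1 | h1
  · rw [halving_eq_self (i := j + 1) (by push_cast; exact h1), halving_eq_self]
    rcases le_total t i with h2 | h2
    · rw [halving_eq_self h2]; linarith
    rcases le_total t (i + 2) with h3 | h3
    · rw [halving_eq_midpoint h2 h3]; linarith
    · rw [halving_eq_sub_one h3]; linarith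
  · rw [halving_eq_sub_one (i := i) (t := t) (by linarith)]
    rcases le_total t (j + 3) with h2 | h2
    · rw [halving_eq_midpoint (i := j) (by linarith) (by linarith),
        halving_eq_midpoint (i := j + 1) (by push_cast; linarith) (by push_cast; linarith),
        halving_eq_sub_one (by push_cast; linarith)]
      push_cast
      ring
    · rw [halving_eq_sub_one (i := j) (by linarith),
        halving_eq_sub_one (i := j + 1) (by push_cast; linarith),
        halving_eq_sub_one (by linarith)]

/-- Thompson's group acting on `ℚ` by piecewise linear maps. -/
def thompsonAction : ThompsonF →* Equiv.Perm ℚ :=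
  PresentedGroup.toGroup (f := halving) (by
    rintro _ ⟨i, j, h, rfl⟩
    simp only [map_mul, map_inv, FreeGroup.lift_apply_of]
    exact mul_inv_eq_one.mpr (halving_comm h))

theorem thompsonAction_X (i : ℕ) : thompsonAction (thompsonX i) = halving i :=
  PresentedGroup.toGroup.of _

theorem thompsonAction_elt_le (i : ℕ) (t : BinTree) (s : ℚ) :
    thompsonAction (elt i t) s ≤ s := by
  induction t generalizing i s with
  | leaf => simp [elt]
  | node a b iha ihb =>
    simp only [elt, map_mul, Equiv.Perm.mul_apply, thompsonAction_X]
    exact (halving_le _ _).trans ((ihb _ _).trans (iha _ _))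

theorem thompsonAction_elt_eq {i : ℕ} (t : BinTree) {s : ℚ} (h : s ≤ i) :
    thompsonAction (elt i t) s = s := by
  induction t generalizing i with
  | leaf => simp [elt]
  | node a b iha ihb =>
    simp only [elt, map_mul, Equiv.Perm.mul_apply, thompsonAction_X]
    rw [iha h, ihb (by push_cast; linarith), halving_eq_self h]

theorem thompsonAction_forestElt_le (i : ℕ) (ts : List BinTree) (s : ℚ) :
    thompsonAction (forestElt i ts) s ≤ s := by
  induction ts generalizing i s with
  | nil => simp [forestElt]
  | cons t ts ih =>
    simp only [forestElt, map_mul, Equiv.Perm.mul_apply]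
    exact (ih _ _).trans (thompsonAction_elt_le _ _ _)

theorem thompsonAction_forestElt_eq {i : ℕ} (ts : List BinTree) {s : ℚ} (h : s ≤ i) :
    thompsonAction (forestElt i ts) s = s := by
  induction ts generalizing i with
  | nil => simp [forestElt]
  | cons t ts ih =>
    simp only [forestElt, map_mul, Equiv.Perm.mul_apply]
    rw [thompsonAction_elt_eq t h, ih (by push_cast; linarith)]

theorem forestElt_leaf_cons (i : ℕ) (ts : List BinTree) :
    forestElt i (leaf :: ts) = forestElt (i + 1) ts := by
  simp [forestElt, elt]

/-- The point i + 1 tells them apart: it is fixed when the first tree is a leaf, and pushed strictly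
to the left by a root caret at i. -/
theorem forestElt_leaf_cons_ne_node_cons (i : ℕ) (a b : BinTree) (ts us : List BinTree) :
    forestElt i (leaf :: ts) ≠ forestElt i (node a b :: us) := by
  intro h
  have h1 : thompsonAction (forestElt i (leaf :: ts)) (i + 1) = i + 1 := by
    rw [forestElt_leaf_cons]
    exact thompsonAction_forestElt_eq ts (by push_cast; exact le_rfl)
  rw [h, forestElt_node_cons, map_mul, Equiv.Perm.mul_apply, thompsonAction_X] at h1
  exact (halving_lt (thompsonAction_forestElt_le i (a :: b :: us) (i + 1))).ne h1

theorem forestLeaves_cons (t : BinTree) (ts : List BinTree) :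
    forestLeaves (t :: ts) = t.leaves + forestLeaves ts := by
  simp [forestLeaves]

/-- Peel off a leading leaf or root caret, which lowers the number of vertices. Equal leaf counts
are needed because trailing one-leaf trees do not change the element. -/
theorem forestElt_injective {i : ℕ} {ts us : List BinTree}
    (hn : forestLeaves ts = forestLeaves us) (h : forestElt i ts = forestElt i us) :
    ts = us := by
  induction hm : (ts.map vertices).sum using Nat.strong_induction_on generalizing i ts us with
  | _ m ih =>
    match ts, us with
    | [], [] => rfl
    | [], u :: us =>
      have := leaves_pos u
      simp only [forestLeaves_cons] at hn
      simp only [forestLeaves, List.map_nil, List.sum_nil] at hn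
      omega
    | t :: ts, [] =>
      have := leaves_pos t
      simp only [forestLeaves_cons] at hn
      simp only [forestLeaves, List.map_nil, List.sum_nil] at hn
      omega
    | leaf :: ts, leaf :: us =>
      rw [forestElt_leaf_cons, forestElt_leaf_cons] at h
      simp only [forestLeaves_cons, add_right_inj] at hn
      simp only [List.map_cons, List.sum_cons, vertices] at hm
      rw [ih _ (by omega) hn h rfl]
    | leaf :: ts, node a b :: us => exact absurd h (forestElt_leaf_cons_ne_node_cons i a b ts us)
    | node a b :: ts, leaf :: us =>
      exact absurd h.symm (forestElt_leaf_cons_ne_node_cons i a b us ts)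
    | node a b :: ts, node c d :: us =>
      rw [forestElt_node_cons, forestElt_node_cons, mul_right_inj] at h
      simp only [forestLeaves_cons, leaves] at hn
      simp only [List.map_cons, List.sum_cons, vertices] at hm
      have := ih (((a :: b :: ts).map vertices).sum)
        (by simp only [List.map_cons, List.sum_cons]; omega)
        (by simp only [forestLeaves_cons]; omega) h rfl
      simp only [List.cons.injEq] at this
      obtain ⟨rfl, rfl, rfl⟩ := this
      rfl

/-! ### The exponent of x_0 -/

/-- The homomorphism to `ℤ` with `x_0 ↦ 1` and `x_n ↦ 0` for `n ≥ 1`. -/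
def zeroExponent : ThompsonF →* Multiplicative ℤ :=
  PresentedGroup.toGroup (f := fun n => if n = 0 then Multiplicative.ofAdd 1 else 1) (by
    rintro _ ⟨i, j, h, rfl⟩
    have hj : j ≠ 0 := by omega
    simp [hj])

theorem zeroExponent_X (i : ℕ) :
    zeroExponent (thompsonX i) = if i = 0 then Multiplicative.ofAdd 1 else 1 :=
  PresentedGroup.toGroup.of _

theorem zeroExponent_elt {i : ℕ} (hi : i ≠ 0) (t : BinTree) : zeroExponent (elt i t) = 1 := by
  induction t generalizing i with
  | leaf => simp [elt]
  | node a b iha ihb => simp [elt, zeroExponent_X, hi, iha hi, ihb (Nat.succ_ne_zero i)]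

theorem zeroExponent_forestElt {i : ℕ} (hi : i ≠ 0) (ts : List BinTree) :
    zeroExponent (forestElt i ts) = 1 := by
  induction ts generalizing i with
  | nil => simp [forestElt]
  | cons t ts ih => simp [forestElt, zeroExponent_elt hi, ih (Nat.succ_ne_zero i)]

theorem thompsonX_zero_ne_one : thompsonX 0 ≠ thompsonX 1 := by
  intro h
  have := congrArg zeroExponent h
  rw [zeroExponent_X, zeroExponent_X] at this
  exact absurd this (by decide)

/-! ### Pointed forests -/

/-- A binary forest with a marked tree: the trees to the left of the marked one (from right to
left), the marked tree, and the trees to its right. -/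
abbrev PointedForest : Type := List BinTree × BinTree × List BinTree

namespace PointedForest

/-- The number of leaves of a pointed forest. -/
def size (y : PointedForest) : ℕ := forestLeaves y.1 + (y.2.1.leaves + forestLeaves y.2.2)

/-- The element of Thompson's group represented by a pointed forest. -/
def toF (y : PointedForest) : ThompsonF :=
  thompsonX 0 ^ y.1.length * forestElt 1 (y.1.reverse ++ y.2.1 :: y.2.2)

theorem toF_shift (L : List BinTree) (t r : BinTree) (R : List BinTree) :
    toF (t :: L, r, R) = thompsonX 0 * toF (L, t, r :: R) := by
  simp [toF, pow_succ', mul_assoc]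

theorem toF_merge (L : List BinTree) (t r : BinTree) (R : List BinTree) :
    toF (L, node t r, R) = thompsonX 1 * toF (L, t, r :: R) := by
  simp only [toF]
  rw [← mul_assoc, thompsonX_one_mul_pow, forestElt_append, forestElt_append, mul_assoc,
    List.length_reverse, add_comm 1, forestElt_node_cons, mul_assoc]

theorem forestLeaves_append_reverse (L R : List BinTree) :
    forestLeaves (L.reverse ++ R) = forestLeaves L + forestLeaves R := by
  simp [forestLeaves, List.sum_reverse]

/-- The forest factor uses only x_n with n ≥ 1, so the exponent of x_0 recovers the pointer
position; cancelling the power of x_0 leaves two forests to compare. -/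
theorem toF_injOn_size {y z : PointedForest} (hs : size y = size z) (h : toF y = toF z) :
    y = z := by
  obtain ⟨L, t, R⟩ := y
  obtain ⟨L', t', R'⟩ := z
  have hl : L.length = L'.length := by
    have := congrArg zeroExponent h
    simp only [toF, map_mul, map_pow, zeroExponent_forestElt one_ne_zero, zeroExponent_X,
      if_true, mul_one, ← ofAdd_nsmul] at this
    simpa using this
  simp only [toF, hl, mul_right_inj] at h
  have := forestElt_injective (by
    simp only [forestLeaves_append_reverse, forestLeaves_cons]; exact hs) h
  obtain ⟨h1, h2⟩ := List.append_inj this (by simpa using hl)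
  simp only [List.cons.injEq] at h2
  rw [List.reverse_injective h1, h2.1, h2.2]

end PointedForest

/-! ### Cheeger boundaries in Cayley graphs -/

namespace SerreGraph

variable {V E L : Type*} (Γ : SerreGraph V E) [Fintype L]

open Classical in
theorem degreeIn_eq_card (ε : V × L ≃ E) (hε : ∀ v l, Γ.init (ε (v, l)) = v) (Y : Finset V)
    (v : V) : Γ.degreeIn Y v = (Finset.univ.filter fun l => Γ.term (ε (v, l)) ∈ Y).card := by
  have hinj : Function.Injective fun l => ε (v, l) := fun l l' h => by simpa using h
  rw [← Finset.card_image_of_injective _ hinj, ← Set.ncard_coe_finset, degreeIn]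
  congr 1
  ext e
  obtain ⟨⟨w, l⟩, rfl⟩ := ε.surjective e
  simp only [Set.mem_ofPred_eq, hε, Finset.coe_image, Finset.coe_filter, Finset.mem_univ,
    true_and, Set.mem_image, EmbeddingLike.apply_eq_iff_eq, Prod.mk.injEq]
  constructor
  · rintro ⟨rfl, h⟩
    exact ⟨l, h, rfl, rfl⟩
  · rintro ⟨l', h, rfl, rfl⟩
    exact ⟨rfl, h⟩

open Classical in
theorem ncard_cheegerBoundary (ε : V × L ≃ E) (hε : ∀ v l, Γ.init (ε (v, l)) = v)
    (Y : Finset V) : (Γ.cheegerBoundary Y).ncard =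
      ∑ v ∈ Y, (Finset.univ.filter fun l => Γ.term (ε (v, l)) ∉ Y).card := by
  rw [← Finset.card_sigma, ← Finset.card_image_of_injective (f := fun x : (_ : V) × L =>
    ε (x.1, x.2)) _ (by rintro ⟨v, l⟩ ⟨v', l'⟩ h; simpa using h), ← Set.ncard_coe_finset]
  congr 1
  ext e
  obtain ⟨⟨w, l⟩, rfl⟩ := ε.surjective e
  simp only [cheegerBoundary, Set.mem_ofPred_eq, hε, Finset.coe_image, Set.mem_image,
    Finset.mem_coe, Finset.mem_sigma, Finset.mem_filter, Finset.mem_univ, true_and,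
    EmbeddingLike.apply_eq_iff_eq, Prod.mk.injEq]
  constructor
  · rintro h
    exact ⟨⟨w, l⟩, h, rfl, rfl⟩
  · rintro ⟨⟨w', l'⟩, h, rfl, rfl⟩
    exact h

theorem subgraphDensity_add_subgraphCheeger (ε : V × L ≃ E)
    (hε : ∀ v l, Γ.init (ε (v, l)) = v) {Y : Finset V} (hY : Y.Nonempty) :
    Γ.subgraphDensity Y + Γ.subgraphCheeger Y = Fintype.card L := by
  classical
  have hc : (Y.card : ℝ) ≠ 0 := by exact_mod_cast hY.card_pos.ne'
  rw [subgraphDensity, subgraphCheeger, ← add_div, div_eq_iff hc,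
    Γ.ncard_cheegerBoundary ε hε, Nat.cast_sum, ← Finset.sum_add_distrib]
  rw [Finset.sum_congr rfl (g := fun _ => (Fintype.card L : ℝ)), Finset.sum_const, nsmul_eq_mul,
    mul_comm]
  intro v _
  rw [Γ.degreeIn_eq_card ε hε, ← Nat.cast_add, Finset.card_filter_add_card_filter_not,
    Finset.card_univ]

/-- In a regular graph a finite subgraph of small Cheeger constant bounds the density from below
and the Cheeger constant from above. -/
theorem density_and_cheegerConstant_of_subgraph (ε : V × L ≃ E)
    (hε : ∀ v l, Γ.init (ε (v, l)) = v) {Y : Finset V} (hY : Y.Nonempty) {c : ℝ}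
    (h : Γ.subgraphCheeger Y < c) :
    (Fintype.card L : ℝ) - c < Γ.density ∧ Γ.cheegerConstant < c ∧
      (Fintype.card L : ℝ) - c < Γ.subgraphDensity Y := by
  have hnn : ∀ Z : Finset V, 0 ≤ Γ.subgraphCheeger Z := fun Z => by
    unfold subgraphCheeger; positivity
  have hd := Γ.subgraphDensity_add_subgraphCheeger ε hε hY
  have hd' : (Fintype.card L : ℝ) - c < Γ.subgraphDensity Y := by linarith
  have hsup : Γ.subgraphDensity Y ≤ Γ.density := by
    rw [density]
    -- Regularity bounds all densities by the degree, so the real supremum is a genuine one.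
    refine le_csSup ⟨Fintype.card L, ?_⟩ ⟨Y, hY, rfl⟩
    rintro _ ⟨Z, hZ, rfl⟩
    have := Γ.subgraphDensity_add_subgraphCheeger ε hε hZ
    linarith [hnn Z]
  have hinf : Γ.cheegerConstant ≤ Γ.subgraphCheeger Y := by
    rw [cheegerConstant]
    refine csInf_le ⟨0, ?_⟩ ⟨Y, hY, rfl⟩
    rintro _ ⟨Z, -, rfl⟩
    exact hnn Z
  exact ⟨hd'.trans_le hsup, hinf.trans_lt h, hd'⟩

end SerreGraph

/-! ### Boundaries in the two Cayley graphs -/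

section Cayley

variable {G : Type*} [Group G]

/-- The letters of the alphabet `{a, b}` and their inverses. -/
noncomputable def pairLetterEquiv {a b : G} (h : a ≠ b) :
    Bool × Bool ≃ ({a, b} : Set G) × Bool :=
  Equiv.prodCongr (Equiv.ofBijective
    (fun i => (if i then ⟨a, by simp⟩ else ⟨b, by simp⟩ : ({a, b} : Set G)))
    ⟨by rintro (_ | _) (_ | _) <;> simp [h, h.symm], by
      rintro ⟨x, rfl | rfl⟩
      · exact ⟨true, by simp⟩
      · exact ⟨false, by simp⟩⟩) (Equiv.refl Bool)

theorem letterValue_pairLetterEquiv {a b : G} (h : a ≠ b) (i s : Bool) :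
    letterValue (pairLetterEquiv h (i, s)) =
      if s then (if i then a else b) else (if i then a else b)⁻¹ := by
  cases i <;> cases s <;> rfl

/-- The directed edges of the right Cayley graph, by initial vertex and label. -/
def rightEdgeEquiv {L : Type*} {A : Set G} (e : L ≃ A × Bool) : G × L ≃ G × (A × Bool) :=
  Equiv.prodCongr (Equiv.refl G) e

/-- The directed edges of the left Cayley graph, by initial vertex and label. -/
def leftEdgeEquiv {L : Type*} {A : Set G} (e : L ≃ A × Bool) : G × L ≃ (A × Bool) × G where
  toFun x := (e x.2, (letterValue (e x.2))⁻¹ * x.1)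
  invFun x := (letterValue x.1 * x.2, e.symm x.1)
  left_inv x := by simp
  right_inv x := by simp

-- The map y ↦ a⁻¹y matches the points that a⁻¹ keeps in Y with those that a keeps, so equally many
-- leave. This is the factor 2 in the boundary counts.
open Classical in
theorem card_filter_inv_mul_notMem (Y : Finset G) (a : G) :
    (Y.filter fun y => a⁻¹ * y ∉ Y).card = (Y.filter fun y => a * y ∉ Y).card := by
  have h1 : (Y.filter fun y => a⁻¹ * y ∈ Y).card = (Y.filter fun y => a * y ∈ Y).card := by
    refine Finset.card_bij (fun y _ => a⁻¹ * y) ?_ ?_ ?_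
    · intro y hy
      simpa [and_comm] using hy
    · intro y _ z _ hyz
      simpa using hyz
    · intro z hz
      exact ⟨a * z, by simpa [and_comm] using hz, by simp⟩
  have h2 := Finset.card_filter_add_card_filter_not (s := Y) (fun y => a⁻¹ * y ∈ Y)
  have h3 := Finset.card_filter_add_card_filter_not (s := Y) (fun y => a * y ∈ Y)
  omega

theorem sum_bool_mul_bool {f : Bool × Bool → ℕ} : ∑ l, f l =
    f (true, true) + f (true, false) + (f (false, true) + f (false, false)) := by
  simp [Fintype.sum_prod_type]

open Classical in
theorem ncard_cheegerBoundary_leftCayleyGraph {a b : G} (h : a ≠ b) (Y : Finset G) :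
    ((leftCayleyGraph G {a, b}).cheegerBoundary Y).ncard =
      2 * ((Y.filter fun y => a * y ∉ Y).card + (Y.filter fun y => b * y ∉ Y).card) := by
  rw [SerreGraph.ncard_cheegerBoundary _ (leftEdgeEquiv (pairLetterEquiv h))
    (fun v l => by simp [leftEdgeEquiv, leftCayleyGraph])]
  simp only [Finset.card_filter]
  rw [Finset.sum_comm, sum_bool_mul_bool]
  simp only [leftEdgeEquiv, leftCayleyGraph, letterValue_pairLetterEquiv, Equiv.coe_fn_mk, if_true,
    Bool.false_eq_true, if_false, inv_inv, ← Finset.card_filter, card_filter_inv_mul_notMem]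
  ring

-- Inversion exchanges left and right multiplication, so the inverses of a good set for the left
-- graph serve the right one.
open Classical in
theorem ncard_cheegerBoundary_rightCayleyGraph_inv {a b : G} (h : a ≠ b) (Y : Finset G) :
    ((rightCayleyGraph G {a, b}).cheegerBoundary (Y.image (·⁻¹))).ncard =
      2 * ((Y.filter fun y => a * y ∉ Y).card + (Y.filter fun y => b * y ∉ Y).card) := by
  rw [SerreGraph.ncard_cheegerBoundary _ (rightEdgeEquiv (pairLetterEquiv h))
    (fun v l => by simp [rightEdgeEquiv, rightCayleyGraph])]
  have hm : ∀ x : G, x ∈ Y.image (·⁻¹) ↔ x⁻¹ ∈ Y := fun x => by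
    simp only [Finset.mem_image]
    exact ⟨fun ⟨y, hy, hx⟩ => by simpa [← hx] using hy, fun hx => ⟨_, hx, inv_inv x⟩⟩
  rw [Finset.sum_image inv_injective.injOn]
  simp only [Finset.card_filter]
  rw [Finset.sum_comm, sum_bool_mul_bool]
  simp only [rightEdgeEquiv, rightCayleyGraph, letterValue_pairLetterEquiv, hm,
    Equiv.prodCongr_apply, Prod.map, Equiv.refl_apply, if_true,
    Bool.false_eq_true, if_false, inv_inv, mul_inv_rev, ← Finset.card_filter,
    card_filter_inv_mul_notMem]
  ring

open Classical in
/-- A finite set with few points moved out of it by `a` and by `b` bounds the densities and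
Cheeger constants of both Cayley graphs. -/
theorem cayleyGraph_bounds {a b : G} (h : a ≠ b) {Y : Finset G} (hY : Y.Nonempty) {c : ℝ}
    (hc : 2 * (((Y.filter fun y => a * y ∉ Y).card : ℝ) + (Y.filter fun y => b * y ∉ Y).card)
      < c * Y.card) :
    (4 - c < (rightCayleyGraph G {a, b}).density ∧
      (rightCayleyGraph G {a, b}).cheegerConstant < c ∧
      ∃ Z : Finset G, Z.Nonempty ∧ 4 - c < (rightCayleyGraph G {a, b}).subgraphDensity Z) ∧
    (4 - c < (leftCayleyGraph G {a, b}).density ∧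
      (leftCayleyGraph G {a, b}).cheegerConstant < c ∧
      ∃ Z : Finset G, Z.Nonempty ∧ 4 - c < (leftCayleyGraph G {a, b}).subgraphDensity Z) := by
  have hpos : (0 : ℝ) < Y.card := by exact_mod_cast hY.card_pos
  have hL : ((Fintype.card (Bool × Bool) : ℕ) : ℝ) = 4 := by norm_num
  constructor
  · have h1 := (rightCayleyGraph G {a, b}).density_and_cheegerConstant_of_subgraph
      (rightEdgeEquiv (pairLetterEquiv h))
      (fun v l => by simp [rightEdgeEquiv, rightCayleyGraph])
      (Y := Y.image (·⁻¹)) (hY.image _) (c := c) (by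
        rw [SerreGraph.subgraphCheeger, ncard_cheegerBoundary_rightCayleyGraph_inv h,
          Finset.card_image_of_injective _ inv_injective, div_lt_iff₀ hpos]
        exact_mod_cast hc)
    rw [hL] at h1
    exact ⟨h1.1, h1.2.1, _, hY.image _, h1.2.2⟩
  · have h1 := (leftCayleyGraph G {a, b}).density_and_cheegerConstant_of_subgraph
      (leftEdgeEquiv (pairLetterEquiv h))
      (fun v l => by simp [leftEdgeEquiv, leftCayleyGraph])
      hY (c := c) (by
        rw [SerreGraph.subgraphCheeger, ncard_cheegerBoundary_leftCayleyGraph h,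
          div_lt_iff₀ hpos]
        exact_mod_cast hc)
    rw [hL] at h1
    exact ⟨h1.1, h1.2.1, _, hY, h1.2.2⟩

end Cayley

/-! ### Finite families of pointed forests -/

/-- The binary trees of height at most `k`. -/
def treesUpTo : ℕ → Finset BinTree
  | 0 => {leaf}
  | k + 1 => insert leaf ((treesUpTo k ×ˢ treesUpTo k).image fun p => node p.1 p.2)

theorem leaf_mem_treesUpTo (k : ℕ) : leaf ∈ treesUpTo k := by
  cases k <;> simp [treesUpTo]

theorem node_mem_treesUpTo_succ {k : ℕ} {a b : BinTree} :
    node a b ∈ treesUpTo (k + 1) ↔ a ∈ treesUpTo k ∧ b ∈ treesUpTo k := by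
  simp [treesUpTo]

theorem treesUpTo_subset_succ (k : ℕ) : treesUpTo k ⊆ treesUpTo (k + 1) := by
  induction k with
  | zero => simp [treesUpTo]
  | succ k ih =>
    intro t ht
    cases t with
    | leaf => exact leaf_mem_treesUpTo _
    | node a b =>
      rw [node_mem_treesUpTo_succ] at ht ⊢
      exact ⟨ih ht.1, ih ht.2⟩

/-- The generating function of the trees of height at most `k` by the number of leaves. -/
def heightSeries (x : ℝ) : ℕ → ℝ
  | 0 => x
  | k + 1 => x + heightSeries x k ^ 2

theorem sum_treesUpTo (x : ℝ) (k : ℕ) :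
    ∑ t ∈ treesUpTo k, x ^ t.leaves = heightSeries x k := by
  induction k with
  | zero => simp [treesUpTo, heightSeries, leaves]
  | succ k ih =>
    rw [treesUpTo, Finset.sum_insert (by simp), Finset.sum_image (by
      rintro ⟨a, b⟩ _ ⟨c, d⟩ _ h; simpa using h), heightSeries, ← ih, sq, Finset.sum_mul_sum,
      Finset.sum_product]
    simp [leaves, pow_add]

/-- The lists of length less than `m` with entries in `T`. -/
def listsBelow (T : Finset BinTree) : ℕ → Finset (List BinTree)
  | 0 => ∅
  | m + 1 => insert [] ((T ×ˢ listsBelow T m).image fun p => p.1 :: p.2)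

theorem cons_mem_listsBelow {T : Finset BinTree} {m : ℕ} {t : BinTree} {L : List BinTree} :
    t :: L ∈ listsBelow T m ↔ t ∈ T ∧ L ∈ listsBelow T m ∧ L.length + 1 < m := by
  induction m generalizing t L with
  | zero => simp [listsBelow]
  | succ m ih =>
    cases L with
    | nil => cases m <;> simp [listsBelow]
    | cons s L =>
      have h : ∀ (u : BinTree) (M : List BinTree),
          u :: M ∈ listsBelow T (m + 1) ↔ u ∈ T ∧ M ∈ listsBelow T m := by
        intro u M; simp [listsBelow]
      rw [h, h, ih]
      simp only [List.length_cons, add_lt_add_iff_right]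
      tauto

theorem length_lt_of_mem_listsBelow {T : Finset BinTree} {m : ℕ} {L : List BinTree}
    (h : L ∈ listsBelow T m) : L.length < m := by
  cases L with
  | nil => cases m <;> simp_all [listsBelow]
  | cons t L => exact (cons_mem_listsBelow.mp h).2.2

theorem sum_listsBelow_succ (T : Finset BinTree) (m : ℕ) (f : List BinTree → ℝ) :
    ∑ L ∈ listsBelow T (m + 1), f L = f [] + ∑ t ∈ T, ∑ L ∈ listsBelow T m, f (t :: L) := by
  rw [listsBelow, Finset.sum_insert (by simp), Finset.sum_image (by
    rintro ⟨a, b⟩ _ ⟨c, d⟩ _ h; simpa using h), Finset.sum_product]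

/-- The head of the list satisfies `p` and its tail satisfies `Q`. -/
def Headed (p : BinTree → Prop) (Q : List BinTree → Prop) : List BinTree → Prop
  | [] => False
  | t :: L => p t ∧ Q L

open Classical in
/-- The sum of the weights of the elements of `S` that satisfy `P`. -/
noncomputable def sumOver {α : Type*} (S : Finset α) (w : α → ℝ) (P : α → Prop) : ℝ :=
  ∑ a ∈ S.filter P, w a

theorem sumOver_true {α : Type*} (S : Finset α) (w : α → ℝ) :
    sumOver S w (fun _ => True) = ∑ a ∈ S, w a := by
  rw [sumOver, Finset.filter_true]

theorem sumOver_product {α β : Type*} (S : Finset α) (T : Finset β) (v : α → ℝ) (w : β → ℝ)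
    (P : α → Prop) (Q : β → Prop) :
    sumOver (S ×ˢ T) (fun y => v y.1 * w y.2) (fun y => P y.1 ∧ Q y.2) =
      sumOver S v P * sumOver T w Q := by
  simp only [sumOver]
  rw [Finset.sum_mul_sum, ← Finset.sum_product']
  refine Finset.sum_congr ?_ fun _ _ => rfl
  ext y
  simp only [Finset.mem_filter, Finset.mem_product]
  tauto

/-- The total weight of the trees in `T` that satisfy `p`. -/
noncomputable def treeMass (x : ℝ) (T : Finset BinTree) (p : BinTree → Prop) : ℝ :=
  sumOver T (fun t => x ^ t.leaves) p

/-- The total weight of the lists in `listsBelow T m` that satisfy `P`. -/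
noncomputable def listMass (x : ℝ) (T : Finset BinTree) (m : ℕ) (P : List BinTree → Prop) : ℝ :=
  sumOver (listsBelow T m) (fun L => x ^ forestLeaves L) P

/-- The weight is multiplicative in head and tail, and each prescribed head uses up one unit of the
length bound. -/
theorem listMass_headed (x : ℝ) (T : Finset BinTree) (m : ℕ) (p : BinTree → Prop)
    (Q : List BinTree → Prop) :
    listMass x T (m + 1) (Headed p Q) = treeMass x T p * listMass x T m Q := by
  simp only [listMass, treeMass, sumOver]
  rw [Finset.sum_filter, sum_listsBelow_succ, Finset.sum_filter, Finset.sum_filter,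
    Finset.sum_mul_sum]
  rw [if_neg (by simp [Headed]), zero_add]
  refine Finset.sum_congr rfl fun t _ => Finset.sum_congr rfl fun L _ => ?_
  by_cases h1 : p t <;> by_cases h2 : Q L <;>
    simp [Headed, h1, h2, forestLeaves_cons, pow_add]

section Mass

variable {x : ℝ} {T : Finset BinTree} (hT : ∑ t ∈ T, x ^ t.leaves = 1)
include hT

/-- When the trees have total weight 1, so do the lists of each of the m possible lengths. -/
theorem listMass_true (m : ℕ) : listMass x T m (fun _ => True) = m := by
  rw [listMass, sumOver_true]
  induction m with
  | zero => simp [listsBelow]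
  | succ m ih =>
    rw [sum_listsBelow_succ]
    simp only [forestLeaves_cons, pow_add, ← Finset.mul_sum, ih, ← Finset.sum_mul, hT]
    simp [forestLeaves, add_comm]

theorem listMass_length (m : ℕ) : listMass x T (m + 1) (fun L => L.length = m) = 1 := by
  rw [listMass, sumOver, Finset.sum_filter]
  induction m with
  | zero => simp [listsBelow, forestLeaves]
  | succ m ih =>
    rw [sum_listsBelow_succ, if_neg (by simp), zero_add]
    have h (t : BinTree) (L : List BinTree) :
        (if (t :: L).length = m + 1 then x ^ forestLeaves (t :: L) else 0) =
          x ^ t.leaves * if L.length = m then x ^ forestLeaves L else 0 := by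
      simp [forestLeaves_cons, pow_add]
    have ih' : (∑ L ∈ listsBelow T (m + 1), if L.length = m then x ^ forestLeaves L else 0) = 1 := by
      convert ih
    convert hT using 2 with t _
    rw [← mul_one (x ^ t.leaves), ← ih', Finset.mul_sum]
    refine Finset.sum_congr rfl fun L _ => ?_
    rw [← h]
    congr

end Mass

theorem listMass_nil (x : ℝ) (T : Finset BinTree) (m : ℕ) :
    listMass x T (m + 1) (fun L => L = []) = 1 := by
  rw [listMass, sumOver, Finset.sum_filter, sum_listsBelow_succ]
  simp [forestLeaves]

/-! ### The family, the removed patterns and the pointer moves -/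

namespace PointedForest

/-- The pointed forests of trees of height at most `k` with fewer than `m` trees on each side of
the marked one. -/
def family (k m : ℕ) : Finset PointedForest :=
  listsBelow (treesUpTo k) m ×ˢ treesUpTo k ×ˢ listsBelow (treesUpTo k) m

/-- The total weight of the pointed forests in `family k m` that satisfy `P`. -/
noncomputable def mass (x : ℝ) (k m : ℕ) (P : PointedForest → Prop) : ℝ :=
  sumOver (family k m) (fun y => x ^ size y) P

/-- The three parts of a pointed forest are independent. The `True` conjuncts in `MarksFirst` and
`Mergeable` give them this product form. -/
theorem mass_eq_mul (x : ℝ) (k m : ℕ) (P : List BinTree → Prop) (q : BinTree → Prop)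
    (Q : List BinTree → Prop) :
    mass x k m (fun y => P y.1 ∧ q y.2.1 ∧ Q y.2.2) =
      listMass x (treesUpTo k) m P *
        (treeMass x (treesUpTo k) q * listMass x (treesUpTo k) m Q) := by
  rw [mass, listMass, treeMass, listMass, ← sumOver_product, ← sumOver_product]
  simp only [size, pow_add, family]

/-! The marked tree is part of a pattern leaf, high tree, leaf, high tree, where a tree is high
if its height exceeds `k`. -/

/-- The marked tree is the first one in a pattern leaf, high, leaf, high. -/
def MarksFirst (k : ℕ) (y : PointedForest) : Prop :=
  True ∧ y.2.1 = leaf ∧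
    Headed (· ∉ treesUpTo k) (Headed (· = leaf) (Headed (· ∉ treesUpTo k) fun _ => True)) y.2.2

/-- The marked tree is the second one in a pattern leaf, high, leaf, high. -/
def MarksSecond (k : ℕ) (y : PointedForest) : Prop :=
  Headed (· = leaf) (fun _ => True) y.1 ∧ y.2.1 ∉ treesUpTo k ∧
    Headed (· = leaf) (Headed (· ∉ treesUpTo k) fun _ => True) y.2.2

/-- The marked tree is the third one in a pattern leaf, high, leaf, high. -/
def MarksThird (k : ℕ) (y : PointedForest) : Prop :=
  Headed (· ∉ treesUpTo k) (Headed (· = leaf) fun _ => True) y.1 ∧ y.2.1 = leaf ∧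
    Headed (· ∉ treesUpTo k) (fun _ => True) y.2.2

/-- The pointed forests removed from the family. -/
def Removed (k : ℕ) (y : PointedForest) : Prop :=
  MarksFirst k y ∨ MarksSecond k y ∨ MarksThird k y

/-- The marked tree and the next one exist and have height at most `k`. -/
def Mergeable (k : ℕ) (y : PointedForest) : Prop :=
  True ∧ y.2.1 ∈ treesUpTo k ∧ Headed (· ∈ treesUpTo k) (fun _ => True) y.2.2

/-- At each removed position the marked tree or the next one is high. -/
theorem Removed.not_mergeable {k : ℕ} {y : PointedForest} (h : Removed k y) :
    ¬ Mergeable k y := by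
  obtain ⟨L, t, R⟩ := y
  rcases h with h | h | h <;> rcases R with _ | ⟨r, R⟩ <;>
    simp_all [MarksFirst, MarksSecond, MarksThird, Mergeable, Headed]

/-- The pointer moved one tree to the right. -/
def shift : PointedForest → PointedForest
  | (L, t, []) => (L, t, [])
  | (L, t, r :: R) => (t :: L, r, R)

/-- The marked tree merged with the next one. -/
def merge : PointedForest → PointedForest
  | (L, t, []) => (L, t, [])
  | (L, t, r :: R) => (L, node t r, R)

/-- Second and third positions are entered from the first and second, which are removed too. A first
position that is also a third one, in overlapping patterns, is likewise entered from a removed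
second position. -/
theorem removed_shift {k : ℕ} {L R : List BinTree} {t r : BinTree}
    (h : Removed k (t :: L, r, R)) (h' : ¬ Removed k (L, t, r :: R)) :
    MarksFirst k (t :: L, r, R) ∧ ¬ MarksThird k (t :: L, r, R) := by
  simp only [Removed, MarksFirst, MarksSecond, MarksThird, Headed] at *
  tauto

/-- A joined tree is not a leaf, and only the second position marks a non-leaf. -/
theorem removed_merge {k : ℕ} {L R : List BinTree} {t r : BinTree}
    (h : Removed k (L, node t r, R)) : MarksSecond k (L, node t r, R) := by
  rcases h with h | h | h
  · exact absurd h.2.1 (by simp)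
  · exact h
  · exact absurd h.2.1 (by simp)

theorem shift_mem_family {k m : ℕ} {L R : List BinTree} {t r : BinTree}
    (h : (L, t, r :: R) ∈ family k m) (hL : L.length + 1 ≠ m) :
    (t :: L, r, R) ∈ family k m := by
  simp only [family, Finset.mem_product, cons_mem_listsBelow] at h ⊢
  have := length_lt_of_mem_listsBelow h.1
  exact ⟨⟨h.2.1, h.1, by omega⟩, h.2.2.1, h.2.2.2.1⟩

theorem merge_mem_family {k m : ℕ} {L R : List BinTree} {t r : BinTree}
    (h : (L, t, r :: R) ∈ family (k + 1) m) (ht : t ∈ treesUpTo k) (hr : r ∈ treesUpTo k) :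
    (L, node t r, R) ∈ family (k + 1) m := by
  simp only [family, Finset.mem_product, cons_mem_listsBelow] at h ⊢
  exact ⟨h.1, node_mem_treesUpTo_succ.mpr ⟨ht, hr⟩, h.2.2.2.1⟩

theorem size_shift (L R : List BinTree) (t r : BinTree) :
    size (t :: L, r, R) = size (L, t, r :: R) := by
  simp only [size, forestLeaves_cons]; omega

theorem size_merge (L R : List BinTree) (t r : BinTree) :
    size (L, node t r, R) = size (L, t, r :: R) := by
  simp only [size, forestLeaves_cons, leaves]; omega

/-! ### Counting with a fixed number of leaves -/

section Slice

open Classical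

/-- The pointed forests with `n` leaves in the family. -/
noncomputable def slice (k m n : ℕ) : Finset PointedForest :=
  (family (k + 1) m).filter fun y => size y = n

/-- The elements of Thompson's group represented by the pointed forests with `n` leaves that are
not removed. -/
noncomputable def sliceSet (k m n : ℕ) : Finset ThompsonF :=
  ((slice k m n).filter fun y => ¬ Removed k y).image toF

/-- The number of pointed forests with `n` leaves in the family that satisfy `P`. -/
noncomputable def sliceCount (k m n : ℕ) (P : PointedForest → Prop) : ℕ :=
  ((slice k m n).filter P).card

theorem sliceCount_add_sliceCount_not (k m n : ℕ) (P : PointedForest → Prop) :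
    sliceCount k m n P + sliceCount k m n (fun y => ¬ P y) =
      sliceCount k m n (fun _ => True) := by
  simp only [sliceCount, Finset.filter_true]
  convert Finset.card_filter_add_card_filter_not (s := slice k m n) P

theorem sliceCount_mono {k m n : ℕ} {P Q : PointedForest → Prop} (h : ∀ y, P y → Q y) :
    sliceCount k m n P ≤ sliceCount k m n Q :=
  Finset.card_le_card (Finset.monotone_filter_right _ fun y _ => h y)

theorem sliceCount_or_le (k m n : ℕ) (P Q : PointedForest → Prop) :
    sliceCount k m n (fun y => P y ∨ Q y) ≤ sliceCount k m n P + sliceCount k m n Q := by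
  refine (Finset.card_le_card fun y hy => ?_).trans (Finset.card_union_le _ _)
  simpa only [Finset.mem_filter, Finset.mem_union, ← and_or_left] using hy

theorem sliceCount_or {P Q : PointedForest → Prop} (k m n : ℕ) (h : ∀ y, P y → ¬ Q y) :
    sliceCount k m n (fun y => P y ∨ Q y) = sliceCount k m n P + sliceCount k m n Q := by
  rw [sliceCount, sliceCount, sliceCount,
    ← Finset.card_union_of_disjoint (Finset.disjoint_filter.mpr fun y _ => h y)]
  congr 1
  ext y
  simp only [Finset.mem_filter, Finset.mem_union, ← and_or_left]

theorem sliceCount_le_of_injOn {k m n : ℕ} {P Q : PointedForest → Prop}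
    (f : PointedForest → PointedForest)
    (hf : ∀ y ∈ slice k m n, P y → f y ∈ slice k m n ∧ Q (f y))
    (hinj : Set.InjOn f {y | P y}) : sliceCount k m n P ≤ sliceCount k m n Q := by
  refine Finset.card_le_card_of_injOn f (fun y hy => ?_) (hinj.mono fun y hy => ?_)
  · simp only [Finset.coe_filter, Set.mem_ofPred_eq] at hy ⊢
    exact hf y hy.1 hy.2
  · simp only [Finset.coe_filter, Set.mem_ofPred_eq] at hy ⊢
    exact hy.2

variable (k m n : ℕ)

theorem toF_injOn_slice : Set.InjOn toF (slice k m n : Set PointedForest) := by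
  intro y hy z hz h
  simp only [slice, Finset.coe_filter, Set.mem_ofPred_eq] at hy hz
  exact toF_injOn_size (hy.2.trans hz.2.symm) h

theorem mem_slice {y : PointedForest} :
    y ∈ slice k m n ↔ y ∈ family (k + 1) m ∧ size y = n := by
  simp [slice]

theorem toF_mem_sliceSet {y : PointedForest} (hy : y ∈ slice k m n) (h : ¬ Removed k y) :
    toF y ∈ sliceSet k m n :=
  Finset.mem_image_of_mem _ (Finset.mem_filter.mpr ⟨hy, h⟩)

theorem card_sliceSet :
    (sliceSet k m n).card + sliceCount k m n (Removed k) =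
      sliceCount k m n (fun _ => True) := by
  rw [sliceSet, Finset.card_image_of_injOn
    ((toF_injOn_slice k m n).mono (by exact_mod_cast Finset.filter_subset _ _)), add_comm]
  convert sliceCount_add_sliceCount_not k m n (Removed k)
  rw [sliceCount]
  congr!

theorem card_filter_mul_sliceSet_le (g : ThompsonF) :
    ((sliceSet k m n).filter fun y => g * y ∉ sliceSet k m n).card ≤
      sliceCount k m n fun y => ¬ Removed k y ∧ g * toF y ∉ sliceSet k m n := by
  refine (Finset.card_le_card ?_).trans (Finset.card_image_le (f := toF))
  intro x hx
  simp only [sliceSet, Finset.mem_filter, Finset.mem_image] at hx ⊢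
  obtain ⟨⟨y, hy, rfl⟩, hx⟩ := hx
  exact ⟨y, ⟨hy.1, hy.2, hx⟩, rfl⟩

theorem card_shift_boundary_le :
    ((sliceSet k m n).filter fun y => thompsonX 0 * y ∉ sliceSet k m n).card ≤
      sliceCount k m n (fun y => y.2.2 = []) + sliceCount k m n (fun y => y.1.length + 1 = m) +
      sliceCount k m n (fun y => MarksFirst k y ∧ ¬ MarksThird k y) := by
  refine (card_filter_mul_sliceSet_le k m n _).trans ?_
  have h1 : sliceCount k m n (fun y => (¬ Removed k y ∧ thompsonX 0 * toF y ∉ sliceSet k m n) ∧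
      y.2.2 ≠ [] ∧ y.1.length + 1 ≠ m) ≤
      sliceCount k m n (fun y => MarksFirst k y ∧ ¬ MarksThird k y) := by
    refine sliceCount_le_of_injOn shift ?_ ?_
    · rintro ⟨L, t, _ | ⟨r, R⟩⟩ hy h
      · exact absurd rfl h.2.1
      have hs : (t :: L, r, R) ∈ slice k m n := by
        rw [mem_slice] at hy ⊢
        exact ⟨shift_mem_family hy.1 h.2.2, (size_shift L R t r).trans hy.2⟩
      refine ⟨hs, removed_shift ?_ h.1.1⟩
      by_contra hr
      exact h.1.2 (toF_shift L t r R ▸ toF_mem_sliceSet k m n hs hr)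
    · rintro ⟨L, t, _ | ⟨r, R⟩⟩ hy ⟨L', t', _ | ⟨r', R'⟩⟩ hz h
      · exact absurd rfl hy.2.1
      · exact absurd rfl hy.2.1
      · exact absurd rfl hz.2.1
      · simp_all [shift]
  refine le_trans (sliceCount_mono fun y hy => ?_)
    ((sliceCount_or_le k m n _ _).trans (add_le_add (sliceCount_or_le k m n _ _) h1))
  tauto

/-- Removed forests are non-mergeable, so they are subtracted from the non-mergeable exits; a
mergeable forest can exit only by a join into a second position. -/
theorem card_merge_boundary_le :
    ((sliceSet k m n).filter fun y => thompsonX 1 * y ∉ sliceSet k m n).card +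
      sliceCount k m n (Removed k) ≤
      sliceCount k m n (fun y => ¬ Mergeable k y) + sliceCount k m n (MarksSecond k) := by
  refine (add_le_add_left (card_filter_mul_sliceSet_le k m n _) _).trans ?_
  have h1 : sliceCount k m n (fun y => (¬ Removed k y ∧ thompsonX 1 * toF y ∉ sliceSet k m n) ∧
      Mergeable k y) ≤ sliceCount k m n (MarksSecond k) := by
    refine sliceCount_le_of_injOn merge ?_ ?_
    · rintro ⟨L, t, _ | ⟨r, R⟩⟩ hy h
      · exact h.2.2.2.elim
      have hs : (L, node t r, R) ∈ slice k m n := by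
        rw [mem_slice] at hy ⊢
        exact ⟨merge_mem_family hy.1 h.2.2.1 h.2.2.2.1, (size_merge L R t r).trans hy.2⟩
      refine ⟨hs, removed_merge ?_⟩
      by_contra hr
      exact h.1.2 (toF_merge L t r R ▸ toF_mem_sliceSet k m n hs hr)
    · rintro ⟨L, t, _ | ⟨r, R⟩⟩ hy ⟨L', t', _ | ⟨r', R'⟩⟩ hz h
      · exact hy.2.2.2.elim
      · exact hy.2.2.2.elim
      · exact hz.2.2.2.elim
      · simp_all [merge]
  have h2 : sliceCount k m n (fun y => ¬ Removed k y ∧ thompsonX 1 * toF y ∉ sliceSet k m n) ≤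
      sliceCount k m n (fun y => ¬ Mergeable k y ∧ ¬ Removed k y) +
      sliceCount k m n (fun y => (¬ Removed k y ∧ thompsonX 1 * toF y ∉ sliceSet k m n) ∧
        Mergeable k y) := by
    refine le_trans (sliceCount_mono fun y hy => ?_) (sliceCount_or_le k m n _ _)
    tauto
  have h3 : sliceCount k m n (fun y => ¬ Mergeable k y ∧ ¬ Removed k y) +
      sliceCount k m n (Removed k) ≤ sliceCount k m n (fun y => ¬ Mergeable k y) := by
    rw [← sliceCount_or k m n fun y h => h.2]
    exact sliceCount_mono fun y h => h.elim (·.1) Removed.not_mergeable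
  omega

/-- Second positions mark a high tree, the others a leaf; only first and third positions can
coincide. -/
theorem sliceCount_removed :
    sliceCount k m n (Removed k) =
      sliceCount k m n (fun y => MarksFirst k y ∧ ¬ MarksThird k y) +
      sliceCount k m n (MarksSecond k) + sliceCount k m n (MarksThird k) := by
  rw [← sliceCount_or, ← sliceCount_or]
  · congr 1
    ext y
    simp only [Removed]
    tauto
  · rintro y (h | h) h'
    · exact h.2 h'
    · exact h.2.1 (h'.2.1 ▸ leaf_mem_treesUpTo k)
  · rintro y h h'
    exact h'.2.1 (h.1.2.1 ▸ leaf_mem_treesUpTo k)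

end Slice

end PointedForest

open PointedForest

/-! ### The critical weight -/

theorem continuous_heightSeries (k : ℕ) : Continuous fun x => heightSeries x k := by
  induction k with
  | zero => exact continuous_id
  | succ k ih => exact continuous_id.add (ih.pow 2)

theorem heightSeries_nonneg {x : ℝ} (hx : 0 ≤ x) (k : ℕ) : 0 ≤ heightSeries x k := by
  cases k with
  | zero => exact hx
  | succ k => exact add_nonneg hx (sq_nonneg _)

/-- The value 1/2 is the fixed point of s ↦ 1/4 + s². -/
theorem heightSeries_quarter_le (k : ℕ) : heightSeries (1 / 4) k ≤ 1 / 2 := by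
  induction k with
  | zero => norm_num [heightSeries]
  | succ k ih =>
    have := heightSeries_nonneg (x := 1 / 4) (by norm_num) k
    rw [heightSeries]
    nlinarith

/-- Since 1/4 + s² ≥ s, each iteration gains at least d. Hence the critical weight tends to 1/4. -/
theorem mul_le_heightSeries {d : ℝ} (hd : 0 ≤ d) (k : ℕ) :
    k * d ≤ heightSeries (1 / 4 + d) k := by
  induction k with
  | zero => simp only [heightSeries, Nat.cast_zero, zero_mul]; linarith
  | succ k ih =>
    rw [heightSeries]
    push_cast
    nlinarith [sq_nonneg (heightSeries (1 / 4 + d) k - 1 / 2)]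

theorem exists_heightSeries_eq_one {d : ℝ} (hd : 0 < d) :
    ∃ k : ℕ, ∃ x ∈ Set.Icc (1 / 4 : ℝ) (1 / 4 + d), heightSeries x (k + 1) = 1 := by
  obtain ⟨k, hk⟩ := exists_nat_ge (1 / d)
  refine ⟨k, ?_⟩
  have h1 : 1 ≤ heightSeries (1 / 4 + d) (k + 1) := by
    refine le_trans ?_ (mul_le_heightSeries hd.le _)
    rw [div_le_iff₀ hd] at hk
    push_cast
    linarith
  exact intermediate_value_Icc (by linarith) (continuous_heightSeries (k + 1)).continuousOn
    ⟨(heightSeries_quarter_le _).trans (by norm_num), h1⟩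

/-! ### Weighted counts -/

theorem treeMass_leaf (x : ℝ) (k : ℕ) : treeMass x (treesUpTo k) (· = leaf) = x := by
  rw [treeMass, sumOver, Finset.sum_eq_single_of_mem leaf]
  · exact pow_one x
  · simp only [Finset.mem_filter, leaf_mem_treesUpTo, and_self]
  · intro t ht hne
    simp only [Finset.mem_filter] at ht
    exact absurd ht.2 hne

theorem treeMass_low (x : ℝ) (k : ℕ) :
    treeMass x (treesUpTo (k + 1)) (· ∈ treesUpTo k) = heightSeries x k := by
  rw [← sum_treesUpTo, treeMass, sumOver]
  refine Finset.sum_congr ?_ fun _ _ => rfl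
  ext t
  simpa using fun h => treesUpTo_subset_succ k h

theorem treeMass_high (x : ℝ) (k : ℕ) :
    treeMass x (treesUpTo (k + 1)) (· ∉ treesUpTo k) =
      heightSeries x (k + 1) - heightSeries x k := by
  classical
  rw [eq_sub_iff_add_eq', ← sum_treesUpTo x (k + 1), ← treeMass_low x k]
  rw [← Finset.sum_filter_add_sum_filter_not _ (· ∈ treesUpTo k)]
  simp only [treeMass, sumOver]
  congr!

namespace PointedForest

section

variable {x : ℝ} {k : ℕ} (hx : heightSeries x (k + 1) = 1) (m : ℕ)
include hx

theorem treeMass_true_critical : treeMass x (treesUpTo (k + 1)) (fun _ => True) = 1 := by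
  rw [treeMass, sumOver_true, sum_treesUpTo, hx]

theorem listMass_true_critical : listMass x (treesUpTo (k + 1)) m (fun _ => True) = m :=
  listMass_true ((sum_treesUpTo x (k + 1)).trans hx) m

theorem mass_true : mass x (k + 1) m (fun _ => True) = m * m := by
  have := mass_eq_mul x (k + 1) m (fun _ => True) (fun _ => True) (fun _ => True)
  simpa only [treeMass_true_critical hx, listMass_true_critical hx, and_self, one_mul] using this

theorem mass_right_nil : mass x (k + 1) (m + 1) (fun y => y.2.2 = []) = m + 1 := by
  have := mass_eq_mul x (k + 1) (m + 1) (fun _ => True) (fun _ => True) (fun R => R = [])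
  simpa only [treeMass_true_critical hx, listMass_true_critical hx, true_and, listMass_nil,
    mul_one, Nat.cast_add_one] using this

theorem mass_left_full : mass x (k + 1) (m + 1) (fun y => y.1.length + 1 = m + 1) = m + 1 := by
  have := mass_eq_mul x (k + 1) (m + 1) (fun L => L.length = m) (fun _ => True) (fun _ => True)
  simpa only [treeMass_true_critical hx, listMass_true_critical hx, and_true, one_mul,
    listMass_length ((sum_treesUpTo x (k + 1)).trans hx), Nat.cast_add_one, add_left_inj]
    using this

theorem mass_mergeable :
    mass x (k + 1) (m + 1) (Mergeable k) = (m + 1) * m * heightSeries x k ^ 2 := by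
  refine (mass_eq_mul x (k + 1) (m + 1) (fun _ => True) (· ∈ treesUpTo k)
    (Headed (· ∈ treesUpTo k) fun _ => True)).trans ?_
  rw [listMass_true_critical hx, listMass_headed, treeMass_low, listMass_true_critical hx]
  push_cast
  ring

/-- Two leaves of weight x and two high trees of weight 1 - s give the square; m + 3 and m are the
weights of the free left and right lists. -/
theorem mass_marksFirst : mass x (k + 1) (m + 3) (MarksFirst k) =
    (m + 3) * m * (x * (1 - heightSeries x k)) ^ 2 := by
  refine (mass_eq_mul x (k + 1) (m + 3) (fun _ => True) (· = leaf) (Headed (· ∉ treesUpTo k)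
    (Headed (· = leaf) (Headed (· ∉ treesUpTo k) fun _ => True)))).trans ?_
  rw [listMass_true_critical hx, listMass_headed, listMass_headed, listMass_headed,
    treeMass_high, treeMass_leaf, listMass_true_critical hx, hx]
  push_cast
  ring

theorem mass_marksSecond : mass x (k + 1) (m + 3) (MarksSecond k) =
    (m + 2) * (m + 1) * (x * (1 - heightSeries x k)) ^ 2 := by
  refine (mass_eq_mul x (k + 1) (m + 3) (Headed (· = leaf) fun _ => True) (· ∉ treesUpTo k)
    (Headed (· = leaf) (Headed (· ∉ treesUpTo k) fun _ => True))).trans ?_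
  simp only [listMass_headed, treeMass_high, treeMass_leaf, listMass_true_critical hx, hx]
  push_cast
  ring

theorem mass_marksThird : mass x (k + 1) (m + 3) (MarksThird k) =
    (m + 2) * (m + 1) * (x * (1 - heightSeries x k)) ^ 2 := by
  refine (mass_eq_mul x (k + 1) (m + 3) (Headed (· ∉ treesUpTo k) (Headed (· = leaf)
    fun _ => True)) (· = leaf) (Headed (· ∉ treesUpTo k) fun _ => True)).trans ?_
  simp only [listMass_headed, treeMass_high, treeMass_leaf, listMass_true_critical hx, hx]
  push_cast
  ring

end

/-! ### From weights to a single number of leaves -/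

/-- A negative weighted combination of masses comes from a negative combination of the numbers
of pointed forests with some fixed number of leaves. -/
theorem exists_slice_sum_neg {x : ℝ} (hx : 0 ≤ x) (k m : ℕ) {ι : Type*} (s : Finset ι)
    (a : ι → ℝ) (P : ι → PointedForest → Prop) (h : ∑ i ∈ s, a i * mass x (k + 1) m (P i) < 0) :
    ∃ n, ∑ i ∈ s, a i * (sliceCount k m n (P i) : ℝ) < 0 := by
  classical
  by_contra! hn
  refine h.not_ge ?_
  -- Group by the number n of leaves: a mass is the sum of the counts times x^n ≥ 0.
  have h1 : ∀ P : PointedForest → Prop, mass x (k + 1) m P =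
      ∑ n ∈ (family (k + 1) m).image size, x ^ n * (sliceCount k m n P : ℝ) := by
    intro P
    rw [mass, sumOver, ← Finset.sum_fiberwise_of_maps_to (t := (family (k + 1) m).image size) (g := size)
      fun y hy => Finset.mem_image_of_mem _ (Finset.mem_filter.mp hy).1]
    refine Finset.sum_congr rfl fun n _ => ?_
    rw [sliceCount, slice, Finset.filter_filter, Finset.filter_filter,
      Finset.filter_congr fun y _ => and_comm, Finset.sum_congr rfl (g := fun _ => x ^ n)
        fun y hy => by rw [(Finset.mem_filter.mp hy).2.1], Finset.sum_const, nsmul_eq_mul, mul_comm]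
  simp only [h1, Finset.mul_sum]
  rw [Finset.sum_comm]
  refine Finset.sum_nonneg fun n _ => ?_
  have := mul_nonneg (pow_nonneg hx n) (hn n)
  rw [Finset.mul_sum] at this
  simpa only [mul_left_comm] using this

/-- Divided by m², the leading term is 1/2400 + 2(x - 1/4) - b/2, at most 1/2400 + 1/10000 - 0.00056
< 0. The size of m absorbs the end effects. -/
theorem mass_combination_neg {x : ℝ} {k : ℕ} (hx : heightSeries x (k + 1) = 1)
    (h1 : 1 / 4 ≤ x) (h2 : x ≤ 1 / 4 + 1 / 20000) {m : ℕ} (hm : 1000000 ≤ (m : ℝ)) :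
    2 * mass x (k + 1) (m + 3) (fun y => y.2.2 = []) +
      2 * mass x (k + 1) (m + 3) (fun y => y.1.length + 1 = m + 3) +
      (2 - (1 / 2 - 1 / 2400)) * mass x (k + 1) (m + 3) (fun _ => True) -
      2 * mass x (k + 1) (m + 3) (Mergeable k) + 1 / 2 * mass x (k + 1) (m + 3) (MarksFirst k) +
      1 / 2 * mass x (k + 1) (m + 3) (MarksSecond k) - 3 / 2 * mass x (k + 1) (m + 3) (MarksThird k) < 0 := by
  have e1 := mass_right_nil hx (m + 2)
  have e2 := mass_left_full hx (m + 2)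
  have e3 := mass_true hx (m + 3)
  have e4 := mass_mergeable hx (m + 2)
  rw [mass_marksFirst hx, mass_marksSecond hx, mass_marksThird hx]
  simp only [add_assoc] at e1 e2 e4
  norm_num only at e1 e2 e4
  rw [e1, e2, e3, e4]
  have hs0 := heightSeries_nonneg (by linarith : 0 ≤ x) k
  -- Criticality reads x + s² = 1, so s is at most √3/2.
  have hs : heightSeries x k ^ 2 = 1 - x := by
    rw [heightSeries] at hx; linarith
  have hs1 : heightSeries x k ≤ 0.86603 := by nlinarith
  have hb : 0.0011217 ≤ (x * (1 - heightSeries x k)) ^ 2 := by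
    have : 0.0334925 ≤ x * (1 - heightSeries x k) := by nlinarith
    nlinarith
  rw [hs]
  generalize (x * (1 - heightSeries x k)) ^ 2 = b at hb
  push_cast
  generalize (m : ℝ) = r at hm
  have hb' : 0.0011217 * (r * (r + 3) / 2 + 2) ≤ b * (r * (r + 3) / 2 + 2) :=
    mul_le_mul_of_nonneg_right hb (by nlinarith)
  have hx' : x * ((r + 3) * (r + 2)) ≤ (1 / 4 + 1 / 20000) * ((r + 3) * (r + 2)) :=
    mul_le_mul_of_nonneg_right h2 (by nlinarith)
  nlinarith

open Classical in
/-- Some slice set has few points moved out of it by the two generators. -/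
theorem exists_sliceSet : ∃ Y : Finset ThompsonF, Y.Nonempty ∧
    2 * (((Y.filter fun y => thompsonX 0 * y ∉ Y).card : ℝ) +
      (Y.filter fun y => thompsonX 1 * y ∉ Y).card) < (1 / 2 - 1 / 2400) * Y.card := by
  obtain ⟨k, x, ⟨h1, h2⟩, hx⟩ := exists_heightSeries_eq_one (d := 1 / 20000) (by norm_num)
  obtain ⟨m, hm⟩ := exists_nat_ge (1000000 : ℝ)
  have hneg := mass_combination_neg hx h1 h2 hm
  obtain ⟨n, hn⟩ := exists_slice_sum_neg (x := x) (by linarith) k (m + 3) Finset.univ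
    -- Twice the exits minus c times the cardinality, c = 1/2 - 1/2400; on removed forests c is
    -- rounded up to 1/2, and -3/2 = 1/2 - 2 includes the saved exits.
    ![2, 2, 2 - (1 / 2 - 1 / 2400), -2, 1 / 2, 1 / 2, -(3 / 2)]
    ![fun y => y.2.2 = [], fun y => y.1.length + 1 = m + 3, fun _ => True, Mergeable k,
      MarksFirst k, MarksSecond k, MarksThird k] (by
      rw [Fin.sum_univ_seven]
      simp only [Matrix.cons_val]
      linarith)
  have hn' : 2 * (sliceCount k (m + 3) n (fun y => y.2.2 = []) : ℝ) +
      2 * sliceCount k (m + 3) n (fun y => y.1.length + 1 = m + 3) +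
      (2 - (1 / 2 - 1 / 2400)) * sliceCount k (m + 3) n (fun _ => True) -
      2 * sliceCount k (m + 3) n (Mergeable k) +
      1 / 2 * sliceCount k (m + 3) n (MarksFirst k) +
      1 / 2 * sliceCount k (m + 3) n (MarksSecond k) -
      3 / 2 * sliceCount k (m + 3) n (MarksThird k) < 0 := by
    rw [Fin.sum_univ_seven] at hn
    simp only [Matrix.cons_val] at hn
    linarith
  have c1 := card_shift_boundary_le k (m + 3) n
  have c2 := card_merge_boundary_le k (m + 3) n
  have c3 := sliceCount_removed k (m + 3) n
  have c4 := card_sliceSet k (m + 3) n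
  have c5 := sliceCount_add_sliceCount_not k (m + 3) n (Mergeable k)
  have c6 : sliceCount k (m + 3) n (fun y => MarksFirst k y ∧ ¬ MarksThird k y) ≤
      sliceCount k (m + 3) n (MarksFirst k) :=
    sliceCount_mono fun _ h => h.1
  have key : 2 * ((((sliceSet k (m + 3) n).filter
        fun y => thompsonX 0 * y ∉ sliceSet k (m + 3) n).card : ℝ) +
      ((sliceSet k (m + 3) n).filter fun y => thompsonX 1 * y ∉ sliceSet k (m + 3) n).card) <
      (1 / 2 - 1 / 2400) * (sliceSet k (m + 3) n).card := by
    clear hn hneg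
    replace c1 := (Nat.cast_le (α := ℝ)).mpr c1
    replace c2 := (Nat.cast_le (α := ℝ)).mpr c2
    replace c3 := congrArg (Nat.cast (R := ℝ)) c3
    replace c4 := congrArg (Nat.cast (R := ℝ)) c4
    replace c5 := congrArg (Nat.cast (R := ℝ)) c5
    replace c6 := (Nat.cast_le (α := ℝ)).mpr c6
    simp only [Nat.cast_add] at c1 c2 c3 c4 c5
    have p1 : (0 : ℝ) ≤ sliceCount k (m + 3) n (MarksSecond k) := Nat.cast_nonneg _
    have p2 : (0 : ℝ) ≤ sliceCount k (m + 3) n (MarksThird k) := Nat.cast_nonneg _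
    have p3 : (0 : ℝ) ≤ sliceCount k (m + 3) n (MarksFirst k) := Nat.cast_nonneg _
    linarith
  refine ⟨sliceSet k (m + 3) n, ?_, key⟩
  rw [Finset.nonempty_iff_ne_empty]
  intro he
  simp [he] at key

end PointedForest

theorem theorem1 :
    ((7 / 2 : ℝ) < (rightCayleyGraph ThompsonF thompsonStd).density ∧
      (rightCayleyGraph ThompsonF thompsonStd).cheegerConstant < (1 / 2 : ℝ) ∧
      ∃ Y : Finset ThompsonF, Y.Nonempty ∧
        (7 / 2 + 1 / 2400 : ℝ) < (rightCayleyGraph ThompsonF thompsonStd).subgraphDensity Y) ∧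
    ((7 / 2 : ℝ) < (leftCayleyGraph ThompsonF thompsonStd).density ∧
      (leftCayleyGraph ThompsonF thompsonStd).cheegerConstant < (1 / 2 : ℝ) ∧
      ∃ Y : Finset ThompsonF, Y.Nonempty ∧
        (7 / 2 + 1 / 2400 : ℝ) < (leftCayleyGraph ThompsonF thompsonStd).subgraphDensity Y) := by
  obtain ⟨Y, hY, h⟩ := PointedForest.exists_sliceSet
  have hc : (4 - (1 / 2 - 1 / 2400) : ℝ) = 7 / 2 + 1 / 2400 := by norm_num
  obtain ⟨⟨r1, r2, r3⟩, l1, l2, l3⟩ := cayleyGraph_bounds thompsonX_zero_ne_one hY h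
  rw [hc] at r1 r3 l1 l3
  exact ⟨⟨by unfold thompsonStd; linarith, by unfold thompsonStd; linarith, r3⟩,
    by unfold thompsonStd; linarith, by unfold thompsonStd; linarith, l3⟩
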